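/- **Setting.** For $v\in\mathbb R^3$ let $S(v)$ be the skew-symmetric matrix with $S(v)w=v\times w$. An attitude representation is an open set $U\subseteq\mathbb R^3$ of parameters $q$ with a $C^1$ kinematic matrix $Z(q)\in\mathbb R^{3\times3}$, invertible for $q\in U$. Examples are the modified Rodrigues parameters (MRP), with $U=\mathbb R^3$ and $Z(q)=\tfrac12\big[\tfrac{1-q^Tq}{2}I+qq^T+S(q)\big]$, and classical Rodrigues parameters, Euler angles or the quaternion vector away from their singularities. Let $J,K_r,\Lambda_r\in\mathbb R^{3\times3}$ be constant symmetric positive definite matrices, $\hat J\in\mathbb R^{3\times 3}$ an estimate of the inertia $J$, and $q_d:\mathbb R\to\mathbb R^3$ a desired trajectory of class $C^2$. Consider the attitude dynamics $$J\dot\omega=(J\omega)\times\omega+u_c+d_{\rm ext},$$ with measured attitude $\hat q(t)\in U$ and measured angular velocity $\hat\omega$ related by $\dot{\hat q}=Z(\hat q)\hat\omega$ (for exact measurements $\hat q=q$, $\hat\omega=\omega$), under the control law $$u_c=\hat J\dot\omega_r-S(\hat J\hat\omega)\,\omega_r-K_r(\hat\omega-\omega_r),\qquad \omega_r=Z^{-1}(\hat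 q)\big(\dot q_d+\Lambda_r(q_d-\hat q)\big).$$ Put $\omega_e=\hat\omega-\omega_r$, $q_e=\hat q-q_d$, $x=(\omega_e,q_e)$, $\Delta\omega=\omega-\hat\omega$, $\Delta J=J-\hat J$, and let $$d_{\rm res,2}=J\Delta\omega\times\hat\omega+J\omega\times\Delta\omega-J\Delta\dot\omega+d_{\rm ext}-\Delta J\,\dot\omega_r+S(\Delta J\hat\omega)\,\omega_r$$ be the resultant disturbance torque. Trajectories are taken on $[0,\infty)$ in the Carathéodory sense ($\omega,\hat\omega$ locally absolutely continuous, the dynamics holding for almost every $t$), and suprema of $d_{\rm res,2}$ over time are essential suprema. Write $\lambda_{\min},\lambda_{\max}$ for extreme eigenvalues and $\sigma_{\max}$ for the largest singular value. Fix $\bar z\in\mathbb R$ and consider all closed-loop trajectories, with arbitrary initial conditions, along which $\sup_{t\ge0}\sigma_{\max}(Z(\hat q(t)))\le\bar z$. **Theorem.** For every $\mu$ with $0<\mu<\min\{\lambda_{\min}(K_r)/\lambda_{\max}(J),\ \lambda_{\min}(\Lambda_r)\}$ there is a $C>0$ such that for all these trajectories: (i) If $d_{\rm res,2}=0$ (almost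 everywhere on $[0,\infty)$), then for all $0\le t_0\le t$ $$\|\hat q(t)-q_d(t)\|_2\le Ce^{-\mu(t-t_0)}\|x(t_0)\|_2\quad\text{and}\quad \|x(t)\|_2\le Ce^{-\mu(t-t_0)}\|x(t_0)\|_2 .$$ (ii) If $d_{\rm res,2}$ is bounded, then the path length $\int_0^{q_e}\|\delta q_e\|_2$ (the infimum of the lengths of $C^1$ paths from $0$ to $q_e(t)$) converges exponentially to a ball: for all $t\ge0$ $$\int_0^{q_e(t)}\|\delta q_e\|_2\le\rho+Ce^{-\mu t}\|x(0)\|_2,\qquad \limsup_{t\to\infty}\int_0^{q_e(t)}\|\delta q_e\|_2\le\rho,$$ $$\rho=\frac{\lambda_{\max}(J)}{\lambda_{\min}(\Lambda_r)\lambda_{\min}(K_r)\lambda_{\min}(J)}\Big(\sup_{t\ge0}\sigma_{\max}(Z(\hat q(t)))\Big)\Big(\sup_{t\ge0}\|d_{\rm res,2}(t)\|_2\Big).$$ Moreover, over all these trajectories the closed loop is (iii) finite-gain $\mathcal L_p$ stable for every $p\in[1,\infty]$: for all $\eta_1,\eta_2\ge0$ there are constants $\gamma,b\ge0$ such that for every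 trajectory, every $\mathbb R^n$-valued output $y$ with $\|y(t)\|\le\eta_1\|x(t)\|+\eta_2\|d_{\rm res,2}(t)\|$ for almost every $t\ge0$, and every $\tau\ge0$, $$\|y\|_{L^p([0,\tau])}\le\gamma\,\|d_{\rm res,2}\|_{L^p([0,\tau])}+b\,\|x(0)\|;$$ (iv) input-to-state stable: there are a class $\mathcal{KL}$ function $\beta$ and a class $\mathcal K$ function $\gamma$ such that, for every trajectory and all $0\le t_0\le t$ for which $d_{\rm res,2}$ is bounded on $[t_0,t]$, $$\|x(t)\|\le\beta(\|x(t_0)\|,t-t_0)+\gamma\Big(\sup_{[t_0,t]}\|d_{\rm res,2}\|\Big).$$ -/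

import Mathlib

open Set Filter MeasureTheory
open scoped ENNReal Matrix Topology

noncomputable section

namespace AttitudeControl

/-- Three-dimensional real space with the Euclidean norm. -/
abbrev E3 : Type := EuclideanSpace ℝ (Fin 3)

/-- Real `3 × 3` matrices. -/
abbrev M3 : Type := Matrix (Fin 3) (Fin 3) ℝ

/-! ### Linear algebra -/

/-- The matrix-vector product `A v`. -/
def act (A : M3) (v : E3) : E3 := WithLp.toLp 2 (A *ᵥ v.ofLp)

/-- The cross product in `ℝ³`. -/
def cross (v w : E3) : E3 := WithLp.toLp 2 (crossProduct v.ofLp w.ofLp)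

/-- The skew-symmetric matrix `S(v)`, characterised by `S(v) w = v × w`. -/
def skew (v : E3) : M3 :=
  !![0, -v 2, v 1;
     v 2, 0, -v 0;
     -v 1, v 0, 0]

/-- Smallest (real) eigenvalue of a symmetric matrix. -/
def lambdaMin (A : M3) : ℝ := sInf (spectrum ℝ A)

/-- Largest (real) eigenvalue of a symmetric matrix. -/
def lambdaMax (A : M3) : ℝ := sSup (spectrum ℝ A)

/-- Largest singular value of a matrix. -/
def sigmaMax (A : M3) : ℝ := √(lambdaMax (Aᵀ * A))

/-- The smallest path integral `∫_a^b ‖δx‖₂`: the infimum of the lengths `∫₀¹ ‖γ'(s)‖₂ ds` of all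
`C¹` paths `γ` from `a` to `b`. -/
def pathLength (a b : E3) : ℝ :=
  sInf {L : ℝ | ∃ γ : ℝ → E3, ContDiff ℝ 1 γ ∧ γ 0 = a ∧ γ 1 = b ∧
    L = ∫ s in (0 : ℝ)..1, ‖deriv γ s‖}

/-! ### Attitude kinematics `q̇ = Z(q) ω` -/

/-- A three-parameter attitude representation: an open set of parameters `q` on which the
kinematic matrix `Z(q)` of the kinematics `q̇ = Z(q) ω` is continuously differentiable and
invertible. Modified Rodrigues parameters (`mrp` below), classical Rodrigues parameters, the
vector part of a quaternion and Euler angles, the last two away from their singularities, are of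
this form. -/
structure AttitudeRep where
  dom : Set E3
  Z : E3 → M3
  isOpen_dom : IsOpen dom
  contDiffOn_Z : ∀ i j, ContDiffOn ℝ 1 (fun q => Z q i j) dom
  isUnit_det_Z : ∀ q ∈ dom, IsUnit (Z q).det

/-- The kinematic matrix of the modified Rodrigues parameters,
`Z(q) = ½ [ ((1 - qᵀq)/2) I + q qᵀ + S(q) ]`. -/
def mrpZ (q : E3) : M3 :=
  (1 / 2 : ℝ) • (((1 - q.ofLp ⬝ᵥ q.ofLp) / 2) • (1 : M3)
    + Matrix.vecMulVec q.ofLp q.ofLp + skew q)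

theorem det_mrpZ (q : E3) :
    (mrpZ q).det = ((1 + q 0 ^ 2 + q 1 ^ 2 + q 2 ^ 2) / 4) ^ 3 := by
  simp [mrpZ, Matrix.det_fin_three, Matrix.vecMulVec_apply, skew, dotProduct, Fin.sum_univ_three]
  ring

/-- Modified Rodrigues parameters, defined on all of `ℝ³`. -/
def mrp : AttitudeRep where
  dom := Set.univ
  Z := mrpZ
  isOpen_dom := isOpen_univ
  contDiffOn_Z := by
    intro i j
    apply ContDiff.contDiffOn
    fin_cases i <;> fin_cases j <;>
      simp [mrpZ, Matrix.vecMulVec_apply, skew, dotProduct, Fin.sum_univ_three] <;> fun_prop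
  isUnit_det_Z := by
    intro q _
    rw [det_mrpZ]
    exact isUnit_iff_ne_zero.mpr (by positivity)

/-! ### The closed loop -/

/-- The data of the attitude tracking problem: the attitude representation, the inertia matrix `J`,
its estimate `Ĵ`, the gains `K_r` and `Λ_r`, and the desired attitude trajectory `q_d`. -/
structure Design where
  rep : AttitudeRep
  J : M3
  Jhat : M3
  K : M3
  Lam : M3
  qd : ℝ → E3

/-- The signals of the closed loop: the measured attitude `q̂`, the angular velocity `ω`, the
measured angular velocity `ω̂` and the external torque `d_ext`. -/
structure Motion where
  qhat : ℝ → E3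
  om : ℝ → E3
  omhat : ℝ → E3
  dext : ℝ → E3

variable (P : Design) (m : Motion)

/-- `ω_r = Z⁻¹(q̂) q̇_d + Z⁻¹(q̂) Λ_r (q_d - q̂)`. -/
def omegaR (t : ℝ) : E3 :=
  act (P.rep.Z (m.qhat t))⁻¹ (deriv P.qd t)
    + act (P.rep.Z (m.qhat t))⁻¹ (act P.Lam (P.qd t - m.qhat t))

/-- `ω_e = ω̂ - ω_r`. -/
def omegaE (t : ℝ) : E3 := m.omhat t - omegaR P m t

/-- The attitude tracking error `q_e = q̂ - q_d`. -/
def qE (t : ℝ) : E3 := m.qhat t - P.qd t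

/-- The control law `u_c = Ĵ ω̇_r - S(Ĵ ω̂) ω_r - K_r (ω̂ - ω_r)`. -/
def controlLaw (t : ℝ) : E3 :=
  act P.Jhat (deriv (omegaR P m) t)
    - act (skew (act P.Jhat (m.omhat t))) (omegaR P m t)
    - act P.K (m.omhat t - omegaR P m t)

/-- The measurement discrepancy `Δω = ω - ω̂`. -/
def deltaOmega (t : ℝ) : E3 := m.om t - m.omhat t

/-- `d_res = (J Δω) × ω̂ + (J ω) × Δω - J Δω̇ + d_ext`. -/
def dRes (t : ℝ) : E3 :=
  cross (act P.J (deltaOmega m t)) (m.omhat t)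
    + cross (act P.J (m.om t)) (deltaOmega m t)
    - act P.J (deriv (deltaOmega m) t) + m.dext t

/-- The resultant disturbance torque `d_res,2 = d_res - ΔJ ω̇_r + S(ΔJ ω̂) ω_r`, `ΔJ = J - Ĵ`. -/
def dRes2 (t : ℝ) : E3 :=
  dRes P m t - act (P.J - P.Jhat) (deriv (omegaR P m) t)
    + act (skew (act (P.J - P.Jhat) (m.omhat t))) (omegaR P m t)

/-- `m` is a (Carathéodory) trajectory on `[0, ∞)` of the closed loop
`J ω̇ = (J ω) × ω + u_c + d_ext`, where `u_c` is the control law evaluated at the measured signals,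
which satisfy the attitude kinematics `d/dt q̂ = Z(q̂) ω̂`. -/
structure IsClosedLoop : Prop where
  mem_dom : ∀ t, 0 ≤ t → m.qhat t ∈ P.rep.dom
  kinematics : ∀ t, 0 ≤ t →
    HasDerivWithinAt m.qhat (act (P.rep.Z (m.qhat t)) (m.omhat t)) (Ici 0) t
  ac_om : ∀ T, 0 ≤ T → AbsolutelyContinuousOnInterval m.om 0 T
  ac_omhat : ∀ T, 0 ≤ T → AbsolutelyContinuousOnInterval m.omhat 0 T
  dynamics : ∀ᵐ t ∂(volume.restrict (Ici (0 : ℝ))),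
    act P.J (deriv m.om t) = cross (act P.J (m.om t)) (m.om t) + controlLaw P m t + m.dext t

/-- The state `(ω_e, q_e)` of the tracking error, with the Euclidean norm. -/
def state (t : ℝ) : WithLp 2 (E3 × E3) := WithLp.toLp 2 (omegaE P m t, qE P m t)

/-- The radius of the error ball,
`λ_max(J) / (λ_min(Λ_r) λ_min(K_r) λ_min(J)) · sup_t σ_max(Z(q̂)) · sup_t ‖d_res,2‖₂`. -/
def ballRadius : ℝ :=
  lambdaMax P.J / (lambdaMin P.Lam * lambdaMin P.K * lambdaMin P.J)
    * (⨆ t : Ici (0 : ℝ), sigmaMax (P.rep.Z (m.qhat t)))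
    * (eLpNorm (dRes2 P m) ∞ (volume.restrict (Ici (0 : ℝ)))).toReal

/-- The pairs (state, disturbance) of all closed-loop trajectories with
`sup_t σ_max(Z(q̂(t))) ≤ zbar`. -/
def behaviour (zbar : ℝ) : Set ((ℝ → WithLp 2 (E3 × E3)) × (ℝ → E3)) :=
  {xd | ∃ m : Motion, IsClosedLoop P m ∧ (∀ t, 0 ≤ t → sigmaMax (P.rep.Z (m.qhat t)) ≤ zbar) ∧
    xd = (state P m, dRes2 P m)}

/-! ### Stability notions -/

/-- Comparison functions of class `𝒦` on `[0, ∞)`. -/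
structure IsClassK (γ : ℝ → ℝ) : Prop where
  continuousOn : ContinuousOn γ (Ici 0)
  strictMonoOn : StrictMonoOn γ (Ici 0)
  map_zero : γ 0 = 0

/-- Comparison functions of class `𝒦ℒ` on `[0, ∞) × [0, ∞)`. -/
structure IsClassKL (β : ℝ → ℝ → ℝ) : Prop where
  continuousOn : ContinuousOn (Function.uncurry β) (Ici 0 ×ˢ Ici 0)
  isClassK : ∀ s, 0 ≤ s → IsClassK fun r => β r s
  antitoneOn : ∀ r, 0 ≤ r → AntitoneOn (β r) (Ici 0)
  tendsto_zero : ∀ r, 0 ≤ r → Tendsto (β r) atTop (𝓝 0)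

/-- Input-to-state stability of a set of pairs (state, input):
`‖x(t)‖ ≤ β(‖x(t₀)‖, t - t₀) + γ(sup_{[t₀, t]} ‖d‖)` whenever `0 ≤ t₀ ≤ t` and the input `d` is
bounded on `[t₀, t]`. -/
def InputToStateStable {X D : Type*} [NormedAddCommGroup X] [NormedAddCommGroup D]
    (B : Set ((ℝ → X) × (ℝ → D))) : Prop :=
  ∃ (β : ℝ → ℝ → ℝ) (γ : ℝ → ℝ), IsClassKL β ∧ IsClassK γ ∧
    ∀ xd ∈ B, ∀ t₀ t : ℝ, 0 ≤ t₀ → t₀ ≤ t →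
      eLpNorm xd.2 ∞ (volume.restrict (Icc t₀ t)) ≠ ∞ →
        ‖xd.1 t‖ ≤ β ‖xd.1 t₀‖ (t - t₀)
          + γ (eLpNorm xd.2 ∞ (volume.restrict (Icc t₀ t))).toReal

/-- Finite-gain `ℒ_p` stability of a set of pairs (state `x`, input `d`): for every output `y` with
`‖y‖ ≤ η₁ ‖x‖ + η₂ ‖d‖`, the truncated norms satisfy `‖y_τ‖_p ≤ gain ‖d_τ‖_p + b ‖x(0)‖`, with
`gain` and `b` independent of the trajectory, of the input and of `τ`. -/
def FiniteGainLpStable {X D : Type*} [NormedAddCommGroup X] [NormedAddCommGroup D]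
    (p : ℝ≥0∞) (B : Set ((ℝ → X) × (ℝ → D))) : Prop :=
  ∀ η₁ η₂ : ℝ, 0 ≤ η₁ → 0 ≤ η₂ → ∃ gain b : ℝ, 0 ≤ gain ∧ 0 ≤ b ∧
    ∀ xd ∈ B, ∀ (n : ℕ) (y : ℝ → EuclideanSpace ℝ (Fin n)),
      (∀ᵐ t ∂(volume.restrict (Ici (0 : ℝ))), ‖y t‖ ≤ η₁ * ‖xd.1 t‖ + η₂ * ‖xd.2 t‖) →
      ∀ τ : ℝ, 0 ≤ τ →
        eLpNorm y p (volume.restrict (Icc 0 τ))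
          ≤ ENNReal.ofReal gain * eLpNorm xd.2 p (volume.restrict (Icc 0 τ))
            + ENNReal.ofReal (b * ‖xd.1 0‖)

end AttitudeControl

end

open AttitudeControl

/-! ### Absolutely continuous functions -/

namespace AbsolutelyContinuousOnInterval

/-! In the error variables the closed loop is a cascade: `J ω̇_e = (J ω̂) × ω_e - K_r ω_e + d_res,2`
drives `q̇_e = Z(q̂) ω_e - Λ_r q_e`. The cross product is orthogonal to `ω_e`, so the weighted norm
`√(ω_eᵀ J ω_e)` decays at rate `λ_min(K_r)/λ_max(J)` up to the disturbance, while `‖q_e‖` decays at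
rate `λ_min(Λ_r)` up to the forcing `σ_max(Z) ‖ω_e‖` (`ae_deriv_norm_omegaE_le`,
`ae_deriv_norm_qE_le`). Both norms are absolutely continuous, so these almost-everywhere
inequalities can be integrated.

Integrating them one after the other gives exactly the radius `ρ` (`norm_qE_le_ballRadius_add`). The
remaining claims use the single function `V = ‖B ω_e‖ + c ‖q_e‖`, `J = Bᵀ B`, which satisfies `V' ≤
-μ V + c₃ ‖d‖` for small `c` (`exists_isLyapunov`). Grönwall then gives exponential convergence and
input-to-state stability; multiplying by `V^(r-1)` and integrating gives the `L^p` gains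
(`exists_eLpNorm_le_of_deriv_le`). Since `V` is of degree one in the state, the disturbance enters
additively. -/

theorem lipschitzOnWith_comp {X Y : Type*} [PseudoMetricSpace X] [PseudoMetricSpace Y]
    {f : ℝ → X} {g : X → Y} {s : Set X} {K : NNReal} {a b : ℝ}
    (hg : LipschitzOnWith K g s) (hf : AbsolutelyContinuousOnInterval f a b)
    (hs : MapsTo f (uIcc a b) s) :
    AbsolutelyContinuousOnInterval (fun t => g (f t)) a b := by
  rw [absolutelyContinuousOnInterval_iff] at hf ⊢
  intro ε hε
  obtain ⟨δ, hδ, h⟩ := hf (ε / (K + 1)) (by positivity)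
  refine ⟨δ, hδ, fun E hE hlen => ?_⟩
  have hE' := (mem_ofPred_eq ▸ hE : _ ∧ _).1
  calc ∑ i ∈ Finset.range E.1, dist (g (f (E.2 i).1)) (g (f (E.2 i).2))
      ≤ ∑ i ∈ Finset.range E.1, K * dist (f (E.2 i).1) (f (E.2 i).2) := by
        refine Finset.sum_le_sum fun i hi => hg.dist_le_mul _ (hs (hE' i hi).1) _ (hs (hE' i hi).2)
    _ = K * ∑ i ∈ Finset.range E.1, dist (f (E.2 i).1) (f (E.2 i).2) := by
        rw [Finset.mul_sum]
    _ ≤ K * (ε / (K + 1)) := by gcongr; exact (h E hE hlen).le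
    _ < (K + 1) * (ε / (K + 1)) := by gcongr; linarith
    _ = ε := by field_simp

theorem lipschitzWith_comp {X Y : Type*} [PseudoMetricSpace X] [PseudoMetricSpace Y]
    {f : ℝ → X} {g : X → Y} {K : NNReal} {a b : ℝ}
    (hg : LipschitzWith K g) (hf : AbsolutelyContinuousOnInterval f a b) :
    AbsolutelyContinuousOnInterval (fun t => g (f t)) a b :=
  hf.lipschitzOnWith_comp hg.lipschitzOnWith (mapsTo_univ _ _)

/-- For `r ≥ 1` the power is `C¹` on all of `ℝ`, hence Lipschitz on a compact interval containing
the values of `f`. -/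
theorem rpow {f : ℝ → ℝ} {a b r : ℝ} (hr : 1 ≤ r)
    (hf : AbsolutelyContinuousOnInterval f a b) :
    AbsolutelyContinuousOnInterval (fun t => f t ^ r) a b := by
  obtain ⟨C, hC⟩ := hf.exists_bound
  have h1 : ContDiff ℝ 1 fun x : ℝ => x ^ r :=
    Real.contDiff_rpow_const_of_le (n := 1) (by simpa using hr)
  obtain ⟨K, hK⟩ := (h1.contDiffOn (s := Icc (-C) C)).exists_lipschitzOnWith (by decide)
    (convex_Icc _ _) isCompact_Icc
  exact hf.lipschitzOnWith_comp (g := fun x : ℝ => x ^ r) hK fun t ht => abs_le.1 (hC t ht)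

theorem ae_differentiableAt_restrict {E : Type*} [NormedAddCommGroup E] [NormedSpace ℝ E]
    [FiniteDimensional ℝ E] {f : ℝ → E} {a b : ℝ} (hab : a ≤ b)
    (hf : AbsolutelyContinuousOnInterval f a b) :
    ∀ᵐ t ∂volume.restrict (Icc a b), DifferentiableAt ℝ f t := by
  rw [ae_restrict_iff' measurableSet_Icc]
  simpa [uIcc_of_le hab] using hf.boundedVariationOn.ae_differentiableAt_of_mem_uIcc

/-- Grönwall's inequality for absolutely continuous functions. -/
theorem le_exp_mul {f : ℝ → ℝ} {a b μ : ℝ} (hab : a ≤ b)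
    (hf : AbsolutelyContinuousOnInterval f a b)
    (h : ∀ᵐ t ∂volume.restrict (Icc a b), deriv f t ≤ -μ * f t) :
    f b ≤ Real.exp (-μ * (b - a)) * f a := by
  have hexp : ContDiff ℝ 1 fun t : ℝ => Real.exp (μ * (t - a)) := by fun_prop
  -- Integrating factor: `e^{μ(t-a)} f` has nonpositive derivative almost everywhere, and absolute
  -- continuity makes its increment the integral of that derivative.
  have hg := hexp.contDiffOn.absolutelyContinuousOnInterval.fun_mul hf
  have h1 := hg.integral_deriv_eq_sub
  have h2 : ∫ t in a..b, deriv (fun t => Real.exp (μ * (t - a)) * f t) t ≤ 0 := by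
    rw [intervalIntegral.integral_of_le hab, ← integral_Icc_eq_integral_Ioc]
    apply integral_nonpos_of_ae
    filter_upwards [h, hf.ae_differentiableAt_restrict hab] with t ht hd
    have he : HasDerivAt (fun t : ℝ => Real.exp (μ * (t - a))) (Real.exp (μ * (t - a)) * μ) t := by
      simpa using (((hasDerivAt_id t).sub_const a).const_mul μ).exp
    have := Real.exp_pos (μ * (t - a))
    refine (he.mul hd.hasDerivAt).deriv.trans_le ?_
    simp only [Pi.zero_apply]
    nlinarith
  rw [h1] at h2
  simp only [sub_self, mul_zero, Real.exp_zero, one_mul] at h2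
  rw [neg_mul, Real.exp_neg, inv_mul_eq_div, le_div_iff₀ (Real.exp_pos _)]
  linarith

/-- Comparison with a solution of a linear scalar differential equation. -/
theorem sub_le_exp_mul_sub {f g h : ℝ → ℝ} {a b μ : ℝ} (hab : a ≤ b)
    (hf : AbsolutelyContinuousOnInterval f a b)
    (hfh : ∀ᵐ t ∂volume.restrict (Icc a b), deriv f t ≤ -μ * f t + h t)
    (hg : ContDiff ℝ 1 g) (hgh : ∀ t, deriv g t = -μ * g t + h t) :
    f b - g b ≤ Real.exp (-μ * (b - a)) * (f a - g a) := by
  refine (hf.fun_sub hg.contDiffOn.absolutelyContinuousOnInterval).le_exp_mul hab ?_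
  filter_upwards [hfh, hf.ae_differentiableAt_restrict hab] with t ht hd
  rw [deriv_fun_sub hd (hg.differentiable one_ne_zero t), hgh]
  linarith

theorem le_of_deriv_le_add_const {f : ℝ → ℝ} {a b μ D : ℝ} (hμ : 0 < μ) (hD : 0 ≤ D) (hab : a ≤ b)
    (hf : AbsolutelyContinuousOnInterval f a b)
    (h : ∀ᵐ t ∂volume.restrict (Icc a b), deriv f t ≤ -μ * f t + D) :
    f b ≤ Real.exp (-μ * (b - a)) * f a + D / μ := by
  have := hf.sub_le_exp_mul_sub (g := fun _ => D / μ) hab h contDiff_const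
    (fun t => by simp; field_simp; ring)
  have h2 : 0 ≤ Real.exp (-μ * (b - a)) * (D / μ) := by positivity
  linarith

/-- The comparison function is the particular solution `C/(μ-ν) e^{-νt} + D/μ`. The gap `ν < μ`
keeps it nonresonant and lets the homogeneous term `e^{-μb} f 0` be absorbed into `e^{-νb}`. -/
theorem le_of_deriv_le_add_exp {f : ℝ → ℝ} {b μ ν C D : ℝ} (hν : ν < μ) (hμ : 0 < μ)
    (hC : 0 ≤ C) (hD : 0 ≤ D) (hb : 0 ≤ b) (hf : AbsolutelyContinuousOnInterval f 0 b)
    (hf0 : 0 ≤ f 0)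
    (h : ∀ᵐ t ∂volume.restrict (Icc 0 b), deriv f t ≤ -μ * f t + (C * Real.exp (-ν * t) + D)) :
    f b ≤ D / μ + (f 0 + C / (μ - ν)) * Real.exp (-ν * b) := by
  have hμν : 0 < μ - ν := by linarith
  have hg : ∀ t, HasDerivAt (fun t => C / (μ - ν) * Real.exp (-ν * t) + D / μ)
      (C / (μ - ν) * (Real.exp (-ν * t) * -ν)) t := fun t => by
    simpa using ((((hasDerivAt_id t).const_mul (-ν)).exp.const_mul (C / (μ - ν))).add_const (D / μ))
  have := hf.sub_le_exp_mul_sub (g := fun t => C / (μ - ν) * Real.exp (-ν * t) + D / μ) hb h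
    (by fun_prop) (fun t => by
    rw [(hg t).deriv]; field_simp; ring)
  simp only [mul_zero, Real.exp_zero, mul_one, sub_zero] at this
  have h1 : Real.exp (-μ * b) ≤ Real.exp (-ν * b) := by
    apply Real.exp_le_exp.2; nlinarith
  have h2 : 0 ≤ Real.exp (-μ * b) * (C / (μ - ν) + D / μ) := by positivity
  have h3 := mul_le_mul_of_nonneg_right h1 hf0
  linarith

end AbsolutelyContinuousOnInterval

/-! ### Differential inequalities for norms and their `L^p` consequences -/

/-- Where `u ≠ 0`, differentiating `‖u‖²` in two ways and cancelling `‖u‖` gives the bound. Where `u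
= 0`, the norm has a minimum, so its derivative vanishes. -/
theorem deriv_norm_le_of_inner_le {E : Type*} [NormedAddCommGroup E] [InnerProductSpace ℝ E]
    {u : ℝ → E} {u' : E} {t k : ℝ} (hu : HasDerivAt u u' t)
    (hn : DifferentiableAt ℝ (fun s => ‖u s‖) t) (h : inner ℝ (u t) u' ≤ ‖u t‖ * k)
    (hk : u t = 0 → 0 ≤ k) : deriv (fun s => ‖u s‖) t ≤ k := by
  by_cases h0 : u t = 0
  · have : IsLocalMin (fun s => ‖u s‖) t := Eventually.of_forall fun s => by simp [h0]
    rw [this.deriv_eq_zero]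
    exact hk h0
  · have h1 := hu.norm_sq.deriv
    have h2 := (hn.hasDerivAt.pow 2).deriv
    have h3 : (fun s => ‖u s‖ ^ 2) = (fun s => ‖u s‖) ^ 2 := rfl
    rw [h3, h2] at h1
    have h4 : 0 < ‖u t‖ := norm_pos_iff.2 h0
    simp only [Nat.cast_ofNat, Nat.add_one_sub_one, pow_one] at h1
    refine le_of_mul_le_mul_left ?_ h4
    linarith

/-- A Young-type inequality, obtained without conjugate exponents: either `y ≤ ε x` or `x ≤ y / ε`,
and each case yields one of the two terms. -/
theorem rpow_sub_one_mul_le {x y ε r : ℝ} (hx : 0 ≤ x) (hy : 0 ≤ y) (hε : 0 < ε) (hr : 1 ≤ r) :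
    x ^ (r - 1) * y ≤ ε * x ^ r + (1 / ε) ^ (r - 1) * y ^ r := by
  have key : ∀ z : ℝ, 0 ≤ z → z ^ (r - 1) * z = z ^ r := fun z hz => by
    rw [← Real.rpow_add_one' hz (by linarith)]; simp
  rcases le_total y (ε * x) with h | h
  · calc x ^ (r - 1) * y ≤ x ^ (r - 1) * (ε * x) := by gcongr
      _ = ε * x ^ r := by rw [← key x hx]; ring
      _ ≤ _ := by linarith [show 0 ≤ (1 / ε) ^ (r - 1) * y ^ r by positivity]
  · have hxy : x ≤ 1 / ε * y := by rw [one_div, inv_mul_eq_div, le_div_iff₀ hε]; linarith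
    calc x ^ (r - 1) * y ≤ (1 / ε * y) ^ (r - 1) * y := by
          gcongr
      _ = (1 / ε) ^ (r - 1) * y ^ r := by
          rw [Real.mul_rpow (by positivity) hy, mul_assoc, key y hy]
      _ ≤ _ := by linarith [show 0 ≤ ε * x ^ r by positivity]

/-- Multiply the inequality by `r f^(r-1)`, integrate, and drop `f(τ)^r ≥ 0`. -/
theorem integral_rpow_le_of_deriv_le {f h : ℝ → ℝ} {μ r τ : ℝ} (hμ : 0 < μ) (hr : 1 ≤ r)
    (hτ : 0 ≤ τ) (hf : AbsolutelyContinuousOnInterval f 0 τ) (hf0 : ∀ t, 0 ≤ f t)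
    (hh0 : ∀ t, 0 ≤ h t) (hhi : IntegrableOn (fun t => h t ^ r) (Icc 0 τ))
    (hfh : ∀ᵐ t ∂volume.restrict (Icc 0 τ), deriv f t ≤ -μ * f t + h t) :
    ∫ t in Icc 0 τ, f t ^ r ≤
      2 / (r * μ) * f 0 ^ r + (2 / μ) ^ r * ∫ t in Icc 0 τ, h t ^ r := by
  have hr0 : 0 < r := by linarith
  have hfr := hf.rpow hr
  have hfi : IntegrableOn (fun t => f t ^ r) (Icc 0 τ) := by
    have := hfr.continuousOn
    rw [uIcc_of_le hτ] at this
    exact this.integrableOn_Icc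
  have hdi : IntegrableOn (deriv fun t => f t ^ r) (Icc 0 τ) := by
    have := hfr.intervalIntegrable_deriv
    rwa [intervalIntegrable_iff_integrableOn_Icc_of_le hτ] at this
  have hI := hfr.integral_deriv_eq_sub
  rw [intervalIntegral.integral_of_le hτ, ← integral_Icc_eq_integral_Ioc] at hI
  have hle : ∀ᵐ t ∂volume.restrict (Icc 0 τ), deriv (fun t => f t ^ r) t ≤
      -(r * μ / 2) * f t ^ r + r * (2 / μ) ^ (r - 1) * h t ^ r := by
    filter_upwards [hfh, hf.ae_differentiableAt_restrict hτ] with t ht hd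
    rw [(hd.hasDerivAt.rpow_const (Or.inr hr)).deriv]
    -- With `ε = μ/2` the mixed term uses up half of the decay; this is the source of the factors 2
    -- in the constants.
    have h1 := rpow_sub_one_mul_le (hf0 t) (hh0 t) (half_pos hμ) hr
    rw [one_div_div] at h1
    have h2 : f t ^ (r - 1) * f t = f t ^ r := by
      rw [← Real.rpow_add_one' (hf0 t) (by linarith)]; simp
    have h3 : 0 ≤ r * f t ^ (r - 1) := mul_nonneg hr0.le (Real.rpow_nonneg (hf0 t) _)
    calc deriv f t * r * f t ^ (r - 1) ≤ (r * f t ^ (r - 1)) * (-μ * f t + h t) := by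
          nlinarith
      _ = -(r * μ) * f t ^ r + r * (f t ^ (r - 1) * h t) := by rw [← h2]; ring
      _ ≤ -(r * μ) * f t ^ r + r * (μ / 2 * f t ^ r + (2 / μ) ^ (r - 1) * h t ^ r) := by gcongr
      _ = _ := by ring
  have hint := integral_mono_ae hdi ((hfi.const_mul _).add (hhi.const_mul _)) hle
  simp only [Pi.add_apply] at hint
  rw [hI, integral_add (hfi.const_mul _) (hhi.const_mul _), integral_const_mul,
    integral_const_mul] at hint
  have h5 : 0 ≤ f τ ^ r := Real.rpow_nonneg (hf0 τ) _
  have h6 : (2 / μ) ^ r = (2 / μ) ^ (r - 1) * (2 / μ) := by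
    rw [← Real.rpow_add_one' (by positivity) (by linarith)]; simp
  have h7 : r * μ / 2 * ∫ t in Icc 0 τ, f t ^ r ≤
      f 0 ^ r + r * (2 / μ) ^ (r - 1) * ∫ t in Icc 0 τ, h t ^ r := by linarith
  have h8 : 0 < r * μ / 2 := by positivity
  rw [h6]
  calc _ = (2 / (r * μ)) * (r * μ / 2 * ∫ t in Icc 0 τ, f t ^ r) := by field_simp
    _ ≤ (2 / (r * μ)) * (f 0 ^ r + r * (2 / μ) ^ (r - 1) * ∫ t in Icc 0 τ, h t ^ r) := by gcongr
    _ = _ := by field_simp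

/-- The `L^p` gain of a scalar exponentially stable differential inequality. -/
theorem exists_eLpNorm_le_of_deriv_le {μ : ℝ} (hμ : 0 < μ) {p : ℝ≥0∞} (hp : 1 ≤ p) :
    ∃ B : ℝ, 0 ≤ B ∧ ∀ (f h : ℝ → ℝ) (τ : ℝ), 0 ≤ τ →
      AbsolutelyContinuousOnInterval f 0 τ → (∀ t, 0 ≤ f t) → (∀ t, 0 ≤ h t) →
      AEStronglyMeasurable h (volume.restrict (Icc 0 τ)) →
      (∀ᵐ t ∂volume.restrict (Icc 0 τ), deriv f t ≤ -μ * f t + h t) →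
      eLpNorm f p (volume.restrict (Icc 0 τ)) ≤
        ENNReal.ofReal (2 / μ) * eLpNorm h p (volume.restrict (Icc 0 τ))
          + ENNReal.ofReal (B * f 0) := by
  have hG : ENNReal.ofReal (2 / μ) ≠ 0 := by
    rw [Ne, ENNReal.ofReal_eq_zero, not_le]; positivity
  by_cases hp' : p = ∞
  · subst hp'
    refine ⟨1, zero_le_one, fun f h τ hτ hf hf0 hh0 hm hfh => ?_⟩
    -- An infinite input norm makes the right-hand side infinite, because the gain is nonzero.
    by_cases hH : eLpNorm h ∞ (volume.restrict (Icc 0 τ)) = ∞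
    · simp [hH, ENNReal.mul_top hG]
    set H := (eLpNorm h ∞ (volume.restrict (Icc 0 τ))).toReal with hHdef
    have hH0 : 0 ≤ H := ENNReal.toReal_nonneg
    have hle : ∀ᵐ t ∂volume.restrict (Icc 0 τ), h t ≤ H := by
      have := ae_le_eLpNormEssSup (f := h) (μ := volume.restrict (Icc 0 τ))
      filter_upwards [this] with t ht
      rw [← eLpNorm_exponent_top] at ht
      have := ENNReal.toReal_mono hH ht
      rw [toReal_enorm, Real.norm_of_nonneg (hh0 t)] at this
      exact this
    have hbd : ∀ t ∈ Icc 0 τ, f t ≤ f 0 + H / μ := by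
      intro t ht
      have := (hf.mono (c := 0) (d := t) (by
        rw [uIcc_of_le hτ, uIcc_of_le ht.1]; exact Icc_subset_Icc_right ht.2)).le_of_deriv_le_add_const
        hμ hH0 ht.1 (D := H) (by
          filter_upwards [ae_mono (Measure.restrict_mono (Icc_subset_Icc_right ht.2) le_rfl) hfh,
            ae_mono (Measure.restrict_mono (Icc_subset_Icc_right ht.2) le_rfl) hle] with s h1 h2
          linarith)
      have h1 : Real.exp (-μ * (t - 0)) ≤ 1 := Real.exp_le_one_iff.2 (by nlinarith [ht.1])
      have := mul_le_mul_of_nonneg_right h1 (hf0 0)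
      linarith
    rw [← ENNReal.ofReal_toReal hH, ← hHdef, ← ENNReal.ofReal_mul (by positivity),
      ← ENNReal.ofReal_add (by positivity) (by simpa using hf0 0), eLpNorm_exponent_top]
    refine eLpNormEssSup_le_of_ae_bound ?_
    filter_upwards [ae_restrict_mem measurableSet_Icc] with t ht
    rw [Real.norm_of_nonneg (hf0 t)]
    have h1 := hbd t ht
    have h2 : H / μ ≤ 2 / μ * H := by
      rw [div_mul_eq_mul_div]; gcongr; linarith
    linarith
  · have hr : 1 ≤ p.toReal := by
      simpa using ENNReal.toReal_mono hp' hp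
    set r := p.toReal with hrdef
    have hr0 : 0 < r := by linarith
    have hp0 : p ≠ 0 := (zero_lt_one.trans_le hp).ne'
    -- The `r`-th root of the coefficient of `f 0 ^ r` in the integral bound; the root is
    -- subadditive since `1/r ≤ 1`.
    refine ⟨(2 / (r * μ)) ^ (1 / r), by positivity, fun f h τ hτ hf hf0 hh0 hm hfh => ?_⟩
    have hnorm : ∀ g : ℝ → ℝ, (∀ t, 0 ≤ g t) → eLpNorm g p (volume.restrict (Icc 0 τ)) =
        (∫⁻ t in Icc 0 τ, ENNReal.ofReal (g t ^ r)) ^ (1 / r) := fun g hg => by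
      rw [eLpNorm_eq_lintegral_rpow_enorm_toReal hp0 hp']
      congr 2
      ext t
      rw [Real.enorm_of_nonneg (hg t), ENNReal.ofReal_rpow_of_nonneg (hg t) hr0.le]
    rw [hnorm f hf0, hnorm h hh0]
    by_cases hH : ∫⁻ t in Icc 0 τ, ENNReal.ofReal (h t ^ r) = ∞
    · rw [hH, ENNReal.top_rpow_of_pos (by positivity), ENNReal.mul_top hG]; simp
    have hhm : AEStronglyMeasurable (fun t => h t ^ r) (volume.restrict (Icc 0 τ)) :=
      (hm.aemeasurable.pow_const r).aestronglyMeasurable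
    have hhi : IntegrableOn (fun t => h t ^ r) (Icc 0 τ) :=
      ⟨hhm, (hasFiniteIntegral_iff_ofReal
        (Eventually.of_forall fun t => Real.rpow_nonneg (hh0 t) r)).2 (lt_top_iff_ne_top.2 hH)⟩
    have hfi : IntegrableOn (fun t => f t ^ r) (Icc 0 τ) := by
      have := (hf.rpow hr).continuousOn
      rw [uIcc_of_le hτ] at this
      exact this.integrableOn_Icc
    have key := integral_rpow_le_of_deriv_le hμ hr hτ hf hf0 hh0 hhi hfh
    rw [← ofReal_integral_eq_lintegral_ofReal hfi
        (Eventually.of_forall fun t => Real.rpow_nonneg (hf0 t) r),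
      ← ofReal_integral_eq_lintegral_ofReal hhi
        (Eventually.of_forall fun t => Real.rpow_nonneg (hh0 t) r)]
    have hI : 0 ≤ ∫ t in Icc 0 τ, h t ^ r := integral_nonneg fun t => Real.rpow_nonneg (hh0 t) r
    have hf0r := Real.rpow_nonneg (hf0 0) r
    have hfI : ∀ x : ℝ, 0 ≤ x → (x ^ r) ^ (1 / r) = x := fun x hx => by
      rw [← Real.rpow_mul hx, mul_one_div_cancel hr0.ne', Real.rpow_one]
    calc _ ≤ (ENNReal.ofReal ((2 / μ) ^ r * ∫ t in Icc 0 τ, h t ^ r) +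
          ENNReal.ofReal (2 / (r * μ) * f 0 ^ r)) ^ (1 / r) := by
          rw [← ENNReal.ofReal_add (by positivity) (by positivity), add_comm]
          gcongr
      _ ≤ (ENNReal.ofReal ((2 / μ) ^ r * ∫ t in Icc 0 τ, h t ^ r)) ^ (1 / r) +
          (ENNReal.ofReal (2 / (r * μ) * f 0 ^ r)) ^ (1 / r) :=
          ENNReal.rpow_add_le_add_rpow _ _ (by positivity) ((div_le_one hr0).2 hr)
      _ = _ := by
          rw [ENNReal.ofReal_rpow_of_nonneg (p := 1 / r) (by positivity) (by positivity),
            ENNReal.ofReal_rpow_of_nonneg (p := 1 / r) (by positivity) (by positivity),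
            ENNReal.ofReal_rpow_of_nonneg (p := 1 / r) hI (by positivity),
            Real.mul_rpow (by positivity) hI, Real.mul_rpow (by positivity) hf0r,
            hfI _ (by positivity), hfI _ (hf0 0), ENNReal.ofReal_mul (by positivity)]

namespace AttitudeControl

/-! ### Matrices acting on `ℝ³` -/

theorem act_eq_toEuclideanCLM (A : M3) (v : E3) : act A v = Matrix.toEuclideanCLM (𝕜 := ℝ) A v :=
  rfl

theorem act_add (A : M3) (v w : E3) : act A (v + w) = act A v + act A w := by
  simp [act_eq_toEuclideanCLM]

theorem act_sub (A : M3) (v w : E3) : act A (v - w) = act A v - act A w := by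
  simp [act_eq_toEuclideanCLM]

theorem act_sub_left (A B : M3) (v : E3) : act (A - B) v = act A v - act B v := by
  simp [act_eq_toEuclideanCLM]

theorem act_mul (A B : M3) (v : E3) : act (A * B) v = act A (act B v) := by
  simp [act_eq_toEuclideanCLM]

theorem act_one (v : E3) : act 1 v = v := by simp [act_eq_toEuclideanCLM]

theorem hasDerivAt_act (A : M3) {v : ℝ → E3} {v' : E3} {t : ℝ} (hv : HasDerivAt v v' t) :
    HasDerivAt (fun s => act A (v s)) (act A v') t :=
  (Matrix.toEuclideanCLM (𝕜 := ℝ) A).hasFDerivAt.comp_hasDerivAt t hv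

theorem inner_act (A : M3) (v w : E3) : inner ℝ v (act A w) = inner ℝ (act Aᵀ v) w := by
  simp only [act, PiLp.inner_apply, Fin.sum_univ_three, Matrix.mulVec, dotProduct,
    Matrix.transpose_apply, RCLike.inner_apply, conj_trivial]
  ring

theorem inner_act_act (B : M3) (v w : E3) :
    inner ℝ (act B v) (act B w) = inner ℝ v (act (Bᵀ * B) w) := by
  rw [act_mul, inner_act Bᵀ, Matrix.transpose_transpose]

theorem act_skew (v w : E3) : act (skew v) w = cross v w := by
  ext i
  fin_cases i <;>
    simp [act, skew, cross, dotProduct, Fin.sum_univ_three, crossProduct] <;> ring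

theorem cross_add_right (u v w : E3) : cross u (v + w) = cross u v + cross u w := by
  simp [cross]

theorem cross_sub_right (u v w : E3) : cross u (v - w) = cross u v - cross u w := by
  simp [cross]

theorem cross_add_left (u v w : E3) : cross (u + v) w = cross u w + cross v w := by
  simp [cross]

theorem cross_sub_left (u v w : E3) : cross (u - v) w = cross u w - cross v w := by
  simp [cross]

theorem inner_cross_self (v w : E3) : inner ℝ w (cross v w) = 0 := by
  simp [cross, crossProduct, PiLp.inner_apply, Fin.sum_univ_three]
  ring

/-! ### Extreme eigenvalues -/

theorem finite_spectrum (A : M3) : (spectrum ℝ A).Finite := by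
  rw [← AlgEquiv.spectrum_eq (Matrix.toLinAlgEquiv' : M3 ≃ₐ[ℝ] _) A]
  exact Module.End.finite_spectrum _

-- The spectrum is finite, so `lambdaMin A` bounds it below, and the spectral bound becomes a
-- Loewner inequality, tested here on `v`.
open scoped MatrixOrder in
theorem lambdaMin_mul_le_inner {A : M3} (hA : A.IsHermitian) (v : E3) :
    lambdaMin A * ‖v‖ ^ 2 ≤ inner ℝ v (act A v) := by
  have h : algebraMap ℝ M3 (lambdaMin A) ≤ A :=
    algebraMap_le_of_le_spectrum (fun x hx => csInf_le (finite_spectrum A).bddBelow hx) hA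
  have h2 := (Matrix.le_iff.1 h).dotProduct_mulVec_nonneg v.ofLp
  rw [Matrix.sub_mulVec, dotProduct_sub, Algebra.algebraMap_eq_smul_one, Matrix.smul_mulVec,
    Matrix.one_mulVec, dotProduct_smul] at h2
  rw [act_eq_toEuclideanCLM, Matrix.inner_toEuclideanCLM, EuclideanSpace.real_norm_sq_eq]
  simp only [dotProduct, smul_eq_mul, star_trivial, sub_nonneg, ← sq] at h2 ⊢
  exact h2

open scoped MatrixOrder in
theorem inner_le_lambdaMax_mul {A : M3} (hA : A.IsHermitian) (v : E3) :
    inner ℝ v (act A v) ≤ lambdaMax A * ‖v‖ ^ 2 := by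
  have h : A ≤ algebraMap ℝ M3 (lambdaMax A) :=
    le_algebraMap_of_spectrum_le (fun x hx => le_csSup (finite_spectrum A).bddAbove hx) hA
  have h2 := (Matrix.le_iff.1 h).dotProduct_mulVec_nonneg v.ofLp
  rw [Matrix.sub_mulVec, dotProduct_sub, Algebra.algebraMap_eq_smul_one, Matrix.smul_mulVec,
    Matrix.one_mulVec, dotProduct_smul] at h2
  rw [act_eq_toEuclideanCLM, Matrix.inner_toEuclideanCLM, EuclideanSpace.real_norm_sq_eq]
  simp only [dotProduct, smul_eq_mul, star_trivial, sub_nonneg, ← sq] at h2 ⊢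
  exact h2

theorem lambdaMin_pos {A : M3} (hA : A.PosDef) : 0 < lambdaMin A := by
  have hr := hA.isHermitian.spectrum_real_eq_range_eigenvalues
  have hne : (spectrum ℝ A).Nonempty := by rw [hr]; exact range_nonempty _
  have hmem := hne.csInf_mem (finite_spectrum A)
  rw [hr] at hmem
  obtain ⟨i, hi⟩ := hmem
  rw [lambdaMin, hr, ← hi]
  exact hA.eigenvalues_pos i

theorem lambdaMin_le_lambdaMax {A : M3} (hA : A.IsHermitian) : lambdaMin A ≤ lambdaMax A := by
  have hne : (spectrum ℝ A).Nonempty := by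
    rw [hA.spectrum_real_eq_range_eigenvalues]; exact range_nonempty _
  exact csInf_le_csSup hne (finite_spectrum A).bddBelow (finite_spectrum A).bddAbove

theorem lambdaMax_pos {A : M3} (hA : A.PosDef) : 0 < lambdaMax A :=
  (lambdaMin_pos hA).trans_le (lambdaMin_le_lambdaMax hA.isHermitian)

theorem norm_act_le (A : M3) (v : E3) : ‖act A v‖ ≤ sigmaMax A * ‖v‖ := by
  have hA : (Aᵀ * A).IsHermitian := by
    simpa using Matrix.isHermitian_conjTranspose_mul_self A
  have h1 : ‖act A v‖ ^ 2 ≤ lambdaMax (Aᵀ * A) * ‖v‖ ^ 2 := by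
    rw [← real_inner_self_eq_norm_sq, inner_act_act]
    exact inner_le_lambdaMax_mul hA v
  calc ‖act A v‖ = √(‖act A v‖ ^ 2) := (Real.sqrt_sq (norm_nonneg _)).symm
    _ ≤ √(lambdaMax (Aᵀ * A) * ‖v‖ ^ 2) := Real.sqrt_le_sqrt h1
    _ = sigmaMax A * ‖v‖ := by
      rw [Real.sqrt_mul' _ (sq_nonneg _), Real.sqrt_sq (norm_nonneg _), sigmaMax]

-- Turns `√(vᵀ A v)` into `‖B v‖`, which is Lipschitz in `v` even at the origin.
open scoped MatrixOrder Matrix.Norms.L2Operator in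
theorem exists_transpose_mul_self {A : M3} (hA : A.PosSemidef) : ∃ B : M3, A = Bᵀ * B := by
  obtain ⟨B, h⟩ := CStarAlgebra.nonneg_iff_eq_star_mul_self.mp hA.nonneg
  exact ⟨B, by simpa [Matrix.star_eq_conjTranspose] using h⟩

/-! ### Path length -/

theorem pathLength_nonneg (a b : E3) : 0 ≤ pathLength a b := by
  apply Real.sInf_nonneg
  rintro _ ⟨γ, -, -, -, rfl⟩
  exact intervalIntegral.integral_nonneg zero_le_one fun s _ => norm_nonneg _

/-- The straight segment is a competitor; the reverse inequality is not needed. -/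
theorem pathLength_zero_le (q : E3) : pathLength 0 q ≤ ‖q‖ := by
  refine csInf_le ⟨0, ?_⟩ ⟨fun s => s • q, by fun_prop, by simp, by simp, ?_⟩
  · rintro _ ⟨γ, -, -, -, rfl⟩
    exact intervalIntegral.integral_nonneg zero_le_one fun s _ => norm_nonneg _
  · have : ∀ s : ℝ, deriv (fun s : ℝ => s • q) s = q := fun s => by
      simpa using ((hasDerivAt_id s).smul_const q).deriv
    simp [this]

end AttitudeControl

namespace AttitudeControl

/-! ### Smoothness of matrix-vector products and inverse matrices -/

theorem contDiffOn_act {N : ℝ → M3} {v : ℝ → E3} {s : Set ℝ}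
    (hN : ∀ i j, ContDiffOn ℝ 1 (fun t => N t i j) s) (hv : ContDiffOn ℝ 1 v s) :
    ContDiffOn ℝ 1 (fun t => act (N t) (v t)) s := by
  rw [contDiffOn_euclidean] at hv ⊢
  intro i
  simp only [act, Matrix.mulVec, dotProduct]
  exact ContDiffOn.sum fun j _ => (hN i j).mul (hv j)

theorem continuousOn_act {N : ℝ → M3} {v : ℝ → E3} {s : Set ℝ}
    (hN : ∀ i j, ContinuousOn (fun t => N t i j) s) (hv : ContinuousOn v s) :
    ContinuousOn (fun t => act (N t) (v t)) s := by
  refine (PiLp.continuous_toLp 2 _).comp_continuousOn (continuousOn_pi.2 fun i => ?_)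
  simp only [Matrix.mulVec, dotProduct]
  exact continuousOn_finsetSum _ fun j _ => (hN i j).mul
    ((EuclideanSpace.proj (𝕜 := ℝ) j).continuous.comp_continuousOn hv)

theorem contDiffOn_inv_apply {N : ℝ → M3} {s : Set ℝ}
    (hN : ∀ i j, ContDiffOn ℝ 1 (fun t => N t i j) s) (hdet : ∀ t ∈ s, IsUnit (N t).det)
    (i j : Fin 3) : ContDiffOn ℝ 1 (fun t => (N t)⁻¹ i j) s := by
  have hd : ContDiffOn ℝ 1 (fun t => (N t).det) s := by
    simp only [Matrix.det_fin_three]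
    have h00 := hN 0 0; have h01 := hN 0 1; have h02 := hN 0 2
    have h10 := hN 1 0; have h11 := hN 1 1; have h12 := hN 1 2
    have h20 := hN 2 0; have h21 := hN 2 1; have h22 := hN 2 2
    fun_prop
  have hadj : ContDiffOn ℝ 1 (fun t => (N t).adjugate i j) s := by
    simp only [Matrix.adjugate_fin_three]
    have h00 := hN 0 0; have h01 := hN 0 1; have h02 := hN 0 2
    have h10 := hN 1 0; have h11 := hN 1 1; have h12 := hN 1 2
    have h20 := hN 2 0; have h21 := hN 2 1; have h22 := hN 2 2
    fin_cases i <;> fin_cases j <;> simp <;> fun_prop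
  simp only [Matrix.inv_def, Ring.inverse_eq_inv', Matrix.smul_apply, smul_eq_mul]
  exact (hd.inv fun t ht => (hdet t ht).ne_zero).mul hadj

theorem continuous_act (A : M3) : Continuous (act A) :=
  (Matrix.toEuclideanCLM (n := Fin 3) (𝕜 := ℝ) A).continuous

theorem continuous_cross : Continuous fun p : E3 × E3 => cross p.1 p.2 := by
  refine (PiLp.continuous_toLp 2 _).comp (continuous_pi fun i => ?_)
  fin_cases i <;> simp [crossProduct] <;> fun_prop

/-! ### Regularity of closed-loop trajectories -/

theorem continuousOn_Ici_of_absolutelyContinuousOnInterval {E : Type*} [SeminormedAddCommGroup E]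
    {f : ℝ → E} (hf : ∀ T, 0 ≤ T → AbsolutelyContinuousOnInterval f 0 T) :
    ContinuousOn f (Ici 0) := by
  intro t ht
  -- The endpoint `t + 1` makes `[0, t + 1]` a neighbourhood of `t` within `[0, ∞)`.
  have ht1 : 0 ≤ t + 1 := add_nonneg ht zero_le_one
  have h := (hf (t + 1) ht1).continuousOn
  rw [uIcc_of_le ht1, ← Ici_inter_Iic] at h
  exact (h t ⟨ht, (lt_add_one t).le⟩).mono_of_mem_nhdsWithin
    (inter_mem_nhdsWithin _ (Iic_mem_nhds (lt_add_one t)))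

theorem ae_differentiableAt_of_absolutelyContinuousOnInterval {E : Type*} [NormedAddCommGroup E]
    [NormedSpace ℝ E] [FiniteDimensional ℝ E] {f : ℝ → E}
    (hf : ∀ T, 0 ≤ T → AbsolutelyContinuousOnInterval f 0 T) :
    ∀ᵐ t ∂volume.restrict (Ici (0 : ℝ)), DifferentiableAt ℝ f t := by
  rw [ae_restrict_iff' measurableSet_Ici]
  have h : ∀ᵐ t : ℝ, ∀ n : ℕ, t ∈ Icc (0 : ℝ) n → DifferentiableAt ℝ f t :=
    ae_all_iff.2 fun n => (ae_restrict_iff' measurableSet_Icc).1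
      ((hf n n.cast_nonneg).ae_differentiableAt_restrict n.cast_nonneg)
  filter_upwards [h] with t ht h0
  obtain ⟨n, hn⟩ := exists_nat_ge t
  exact ht n ⟨h0, hn⟩

theorem absolutelyContinuousOnInterval_of_contDiffOn_Ici {E : Type*} [NormedAddCommGroup E]
    [NormedSpace ℝ E] {f : ℝ → E} (hf : ContDiffOn ℝ 1 f (Ici 0)) (T : ℝ) (hT : 0 ≤ T) :
    AbsolutelyContinuousOnInterval f 0 T :=
  (hf.mono (by rw [uIcc_of_le hT]; exact Icc_subset_Ici_self)).absolutelyContinuousOnInterval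

namespace IsClosedLoop

variable {P : Design} {m : Motion}

theorem continuousOn_qhat (h : IsClosedLoop P m) : ContinuousOn m.qhat (Ici 0) :=
  fun t ht => (h.kinematics t ht).continuousWithinAt

theorem contDiffOn_qhat (h : IsClosedLoop P m) : ContDiffOn ℝ 1 m.qhat (Ici 0) := by
  rw [contDiffOn_one_iff_derivWithin (uniqueDiffOn_Ici 0)]
  refine ⟨fun t ht => (h.kinematics t ht).differentiableWithinAt, ?_⟩
  have hc : ContinuousOn (fun t => act (P.rep.Z (m.qhat t)) (m.omhat t)) (Ici 0) :=
    continuousOn_act (fun i j => (P.rep.contDiffOn_Z i j).continuousOn.comp h.continuousOn_qhat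
      h.mem_dom) (continuousOn_Ici_of_absolutelyContinuousOnInterval h.ac_omhat)
  exact hc.congr fun t ht => (h.kinematics t ht).derivWithin (uniqueDiffOn_Ici 0 t ht)

/-- `ω_r` contains `q̇_d` and `Z⁻¹(q̂)`, so this is where `q_d ∈ C²` and `Z ∈ C¹` are used. -/
theorem contDiffOn_omegaR (h : IsClosedLoop P m) (hqd : ContDiff ℝ 2 P.qd) :
    ContDiffOn ℝ 1 (omegaR P m) (Ici 0) := by
  have hinv := contDiffOn_inv_apply (fun i j => (P.rep.contDiffOn_Z i j).comp h.contDiffOn_qhat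
    h.mem_dom) (fun t ht => P.rep.isUnit_det_Z _ (h.mem_dom t ht))
  have hqd' : ContDiff ℝ 1 (deriv P.qd) :=
    (contDiff_succ_iff_deriv (n := 1) (f := P.qd)).1 (by simpa [one_add_one_eq_two] using hqd) |>.2.2
  exact (contDiffOn_act hinv hqd'.contDiffOn).add (contDiffOn_act hinv (contDiffOn_act
    (fun i j => contDiffOn_const) ((hqd.of_le one_le_two).contDiffOn.sub h.contDiffOn_qhat)))

theorem contDiffOn_qE (h : IsClosedLoop P m) (hqd : ContDiff ℝ 2 P.qd) :
    ContDiffOn ℝ 1 (qE P m) (Ici 0) :=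
  h.contDiffOn_qhat.sub (hqd.of_le one_le_two).contDiffOn

theorem ac_omegaR (h : IsClosedLoop P m) (hqd : ContDiff ℝ 2 P.qd) (T : ℝ) (hT : 0 ≤ T) :
    AbsolutelyContinuousOnInterval (omegaR P m) 0 T :=
  absolutelyContinuousOnInterval_of_contDiffOn_Ici (h.contDiffOn_omegaR hqd) T hT

theorem ac_omegaE (h : IsClosedLoop P m) (hqd : ContDiff ℝ 2 P.qd) (T : ℝ) (hT : 0 ≤ T) :
    AbsolutelyContinuousOnInterval (omegaE P m) 0 T :=
  (h.ac_omhat T hT).fun_sub (h.ac_omegaR hqd T hT)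

theorem ac_qE (h : IsClosedLoop P m) (hqd : ContDiff ℝ 2 P.qd) (T : ℝ) (hT : 0 ≤ T) :
    AbsolutelyContinuousOnInterval (qE P m) 0 T :=
  absolutelyContinuousOnInterval_of_contDiffOn_Ici (h.contDiffOn_qE hqd) T hT

/-! ### Error dynamics -/

/-- The rotational error dynamics `J ω̇_e = (J ω̂) × ω_e - K_r ω_e + d_res,2`. -/
theorem ae_omegaE_dynamics (h : IsClosedLoop P m) (hqd : ContDiff ℝ 2 P.qd) :
    ∀ᵐ t ∂volume.restrict (Ici (0 : ℝ)), act P.J (deriv (omegaE P m) t) =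
      cross (act P.J (m.omhat t)) (omegaE P m t) - act P.K (omegaE P m t) + dRes2 P m t := by
  filter_upwards [h.dynamics, ae_differentiableAt_of_absolutelyContinuousOnInterval h.ac_om,
    ae_differentiableAt_of_absolutelyContinuousOnInterval h.ac_omhat,
    ae_differentiableAt_of_absolutelyContinuousOnInterval (h.ac_omegaR hqd)] with t ht h1 h2 h3
  have e1 : deriv (omegaE P m) t = deriv m.omhat t - deriv (omegaR P m) t := deriv_fun_sub h2 h3
  have e2 : deriv (deltaOmega m) t = deriv m.om t - deriv m.omhat t := deriv_fun_sub h1 h2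
  have e3 : m.om t = m.omhat t + deltaOmega m t := by simp [deltaOmega]
  rw [e1, dRes2, dRes, e2]
  simp only [act_sub, act_sub_left, act_skew, cross_sub_left, controlLaw, omegaE,
    cross_sub_right] at ht ⊢
  rw [ht]
  -- Splitting `ω = ω̂ + Δω` in the gyroscopic term produces the two cross products of `d_res`; the
  -- `Ĵ` and `ΔJ` terms then recombine to `J`.
  rw [show cross (act P.J (m.om t)) (m.om t) = cross (act P.J (m.omhat t)) (m.omhat t)
      + cross (act P.J (deltaOmega m t)) (m.omhat t)
      + cross (act P.J (m.om t)) (deltaOmega m t) by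
    conv_lhs => arg 2; rw [e3]
    rw [cross_add_right, ← cross_add_left, ← act_add, ← e3]]
  abel

/-- The attitude error dynamics `q̇_e = Z(q̂) ω_e - Λ_r q_e`. -/
theorem hasDerivWithinAt_qE (h : IsClosedLoop P m) (hqd : ContDiff ℝ 2 P.qd) {t : ℝ} (ht : 0 ≤ t) :
    HasDerivWithinAt (qE P m)
      (act (P.rep.Z (m.qhat t)) (omegaE P m t) - act P.Lam (qE P m t)) (Ici 0) t := by
  have h1 := (h.kinematics t ht).sub
    ((hqd.differentiable two_ne_zero t).hasDerivAt.hasDerivWithinAt (s := Ici 0))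
  have hZ : ∀ v, act (P.rep.Z (m.qhat t)) (act (P.rep.Z (m.qhat t))⁻¹ v) = v := fun v => by
    rw [← act_mul, Matrix.mul_nonsing_inv _ (P.rep.isUnit_det_Z _ (h.mem_dom t ht)), act_one]
  have e : act (P.rep.Z (m.qhat t)) (omegaE P m t) - act P.Lam (qE P m t) =
      act (P.rep.Z (m.qhat t)) (m.omhat t) - deriv P.qd t := by
    simp only [omegaE, omegaR, act_sub, act_add, hZ, qE]
    abel
  rw [e]
  exact h1

/-- No measurability of `dext` is assumed. Solving the error dynamics for `d_res,2` expresses it,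
almost everywhere, through a derivative and continuous functions. -/
theorem aestronglyMeasurable_dRes2 (h : IsClosedLoop P m) (hqd : ContDiff ℝ 2 P.qd) :
    AEStronglyMeasurable (dRes2 P m) (volume.restrict (Ici (0 : ℝ))) := by
  have hJ := continuous_act P.J
  have he := continuousOn_Ici_of_absolutelyContinuousOnInterval (h.ac_omegaE hqd)
  have ho := continuousOn_Ici_of_absolutelyContinuousOnInterval h.ac_omhat
  have h1 : AEStronglyMeasurable (fun t => act P.J (deriv (omegaE P m) t))
      (volume.restrict (Ici (0 : ℝ))) :=
    hJ.comp_aestronglyMeasurable (aestronglyMeasurable_deriv _ _)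
  have h2 : ContinuousOn (fun t => cross (act P.J (m.omhat t)) (omegaE P m t)) (Ici 0) :=
    continuous_cross.comp_continuousOn (f := fun t => (act P.J (m.omhat t), omegaE P m t))
      ((hJ.comp_continuousOn ho).prodMk he)
  have h3 : ContinuousOn (fun t => act P.K (omegaE P m t)) (Ici 0) := (continuous_act P.K).comp_continuousOn he
  have h4 : dRes2 P m =ᵐ[volume.restrict (Ici (0 : ℝ))] fun t => act P.J (deriv (omegaE P m) t)
      - cross (act P.J (m.omhat t)) (omegaE P m t) + act P.K (omegaE P m t) := by
    filter_upwards [h.ae_omegaE_dynamics hqd] with t ht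
    rw [ht]
    abel
  exact ((h1.fun_sub (h2.aestronglyMeasurable measurableSet_Ici)).fun_add
    (h3.aestronglyMeasurable measurableSet_Ici)).congr h4.symm

theorem ac_norm_act_omegaE (h : IsClosedLoop P m) (hqd : ContDiff ℝ 2 P.qd) (B : M3) (T : ℝ)
    (hT : 0 ≤ T) : AbsolutelyContinuousOnInterval (fun t => ‖act B (omegaE P m t)‖) 0 T :=
  ((h.ac_omegaE hqd T hT).lipschitzWith_comp
    (Matrix.toEuclideanCLM (n := Fin 3) (𝕜 := ℝ) B).lipschitz).lipschitzWith_comp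
    lipschitzWith_one_norm

theorem ac_norm_qE (h : IsClosedLoop P m) (hqd : ContDiff ℝ 2 P.qd) (T : ℝ) (hT : 0 ≤ T) :
    AbsolutelyContinuousOnInterval (fun t => ‖qE P m t‖) 0 T :=
  (h.ac_qE hqd T hT).lipschitzWith_comp lipschitzWith_one_norm

end IsClosedLoop

/-! ### Differential inequalities for the two error norms -/

theorem sqrt_lambdaMin_mul_norm_le {A B : M3} (hA : A.PosDef) (hB : A = Bᵀ * B) (v : E3) :
    √(lambdaMin A) * ‖v‖ ≤ ‖act B v‖ := by
  have h := lambdaMin_mul_le_inner hA.isHermitian v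
  nth_rewrite 2 [hB] at h
  rw [← inner_act_act, real_inner_self_eq_norm_sq] at h
  refine le_of_sq_le_sq ?_ (norm_nonneg _)
  rwa [mul_pow, Real.sq_sqrt (lambdaMin_pos hA).le]

theorem norm_le_sqrt_lambdaMax_mul {A B : M3} (hA : A.PosDef) (hB : A = Bᵀ * B) (v : E3) :
    ‖act B v‖ ≤ √(lambdaMax A) * ‖v‖ := by
  have h := inner_le_lambdaMax_mul hA.isHermitian v
  nth_rewrite 1 [hB] at h
  rw [← inner_act_act, real_inner_self_eq_norm_sq] at h
  refine le_of_sq_le_sq ?_ (by positivity)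
  rwa [mul_pow, Real.sq_sqrt (lambdaMax_pos hA).le]

namespace IsClosedLoop

variable {P : Design} {m : Motion}

theorem ae_deriv_norm_omegaE_le (h : IsClosedLoop P m) (hJ : P.J.PosDef) (hK : P.K.PosDef)
    (hqd : ContDiff ℝ 2 P.qd) {B : M3} (hB : P.J = Bᵀ * B) :
    ∀ᵐ t ∂volume.restrict (Ici (0 : ℝ)), deriv (fun s => ‖act B (omegaE P m s)‖) t ≤
      -(lambdaMin P.K / lambdaMax P.J) * ‖act B (omegaE P m t)‖
        + ‖dRes2 P m t‖ / √(lambdaMin P.J) := by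
  filter_upwards [h.ae_omegaE_dynamics hqd,
    ae_differentiableAt_of_absolutelyContinuousOnInterval (h.ac_omegaE hqd),
    ae_differentiableAt_of_absolutelyContinuousOnInterval (h.ac_norm_act_omegaE hqd B)]
    with t ht h1 h2
  have hs : 0 < √(lambdaMin P.J) := Real.sqrt_pos.2 (lambdaMin_pos hJ)
  refine deriv_norm_le_of_inner_le (hasDerivAt_act B h1.hasDerivAt) h2 ?_ fun h0 => by
    rw [h0]; simp; positivity
  rw [inner_act_act, ← hB, ht, inner_add_right, inner_sub_right, inner_cross_self]
  set e := omegaE P m t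
  set d := dRes2 P m t
  have hk := lambdaMin_mul_le_inner hK.isHermitian e
  have hd : inner ℝ e d ≤ ‖e‖ * ‖d‖ := real_inner_le_norm e d
  have hlow := sqrt_lambdaMin_mul_norm_le hJ hB e
  have hup : ‖act B e‖ ^ 2 ≤ lambdaMax P.J * ‖e‖ ^ 2 := by
    rw [← real_inner_self_eq_norm_sq, inner_act_act, ← hB]
    exact inner_le_lambdaMax_mul hJ.isHermitian e
  have h3 : lambdaMin P.K / lambdaMax P.J * ‖act B e‖ ^ 2 ≤ lambdaMin P.K * ‖e‖ ^ 2 := by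
    rw [div_mul_eq_mul_div, div_le_iff₀ (lambdaMax_pos hJ)]
    nlinarith [lambdaMin_pos hK]
  have h4 : ‖e‖ * ‖d‖ ≤ ‖act B e‖ * (‖d‖ / √(lambdaMin P.J)) := by
    rw [mul_div_assoc', le_div_iff₀ hs]
    nlinarith [norm_nonneg d]
  linarith

theorem ae_deriv_norm_qE_le (h : IsClosedLoop P m) (hLam : P.Lam.PosDef)
    (hqd : ContDiff ℝ 2 P.qd) :
    ∀ᵐ t ∂volume.restrict (Ici (0 : ℝ)), deriv (fun s => ‖qE P m s‖) t ≤
      -lambdaMin P.Lam * ‖qE P m t‖ + sigmaMax (P.rep.Z (m.qhat t)) * ‖omegaE P m t‖ := by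
  filter_upwards [ae_differentiableAt_of_absolutelyContinuousOnInterval (h.ac_qE hqd),
    ae_differentiableAt_of_absolutelyContinuousOnInterval (h.ac_norm_qE hqd),
    ae_restrict_mem measurableSet_Ici] with t h1 h2 ht
  -- The kinematics only give a derivative within `[0, ∞)`; it agrees with the two-sided one where
  -- the latter exists.
  have h3 := (uniqueDiffOn_Ici (0 : ℝ) t ht).eq_deriv _ h1.hasDerivAt.hasDerivWithinAt
    (h.hasDerivWithinAt_qE hqd ht)
  refine deriv_norm_le_of_inner_le h1.hasDerivAt h2 ?_ fun h0 => by
    rw [h0]; simp; exact mul_nonneg (Real.sqrt_nonneg _) (norm_nonneg _)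
  rw [h3, inner_sub_right]
  have h4 := lambdaMin_mul_le_inner hLam.isHermitian (qE P m t)
  have h5 := (real_inner_le_norm (qE P m t) (act (P.rep.Z (m.qhat t)) (omegaE P m t))).trans
    (mul_le_mul_of_nonneg_left (norm_act_le _ _) (norm_nonneg _))
  linarith

end IsClosedLoop

end AttitudeControl

namespace AttitudeControl

/-! ### Lyapunov functions and the stability they imply -/

theorem norm_state_sq (P : Design) (m : Motion) (t : ℝ) :
    ‖state P m t‖ ^ 2 = ‖omegaE P m t‖ ^ 2 + ‖qE P m t‖ ^ 2 :=
  WithLp.prod_norm_sq_eq_of_L2 _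

theorem norm_omegaE_le_norm_state (P : Design) (m : Motion) (t : ℝ) :
    ‖omegaE P m t‖ ≤ ‖state P m t‖ := by
  refine le_of_sq_le_sq ?_ (norm_nonneg _)
  rw [norm_state_sq]
  exact le_add_of_nonneg_right (sq_nonneg _)

theorem norm_qE_le_norm_state (P : Design) (m : Motion) (t : ℝ) :
    ‖qE P m t‖ ≤ ‖state P m t‖ := by
  refine le_of_sq_le_sq ?_ (norm_nonneg _)
  rw [norm_state_sq]
  exact le_add_of_nonneg_left (sq_nonneg _)

theorem norm_state_le (P : Design) (m : Motion) (t : ℝ) :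
    ‖state P m t‖ ≤ ‖omegaE P m t‖ + ‖qE P m t‖ := by
  refine le_of_sq_le_sq ?_ (by positivity)
  rw [norm_state_sq]
  nlinarith [mul_nonneg (norm_nonneg (omegaE P m t)) (norm_nonneg (qE P m t))]

/-- `V` is a Lyapunov function, equivalent to the norm of `x`, that witnesses exponential
stability with rate `μ` under the disturbance `d`. -/
structure IsLyapunov {X D : Type*} [NormedAddCommGroup X] [NormedAddCommGroup D]
    (c₁ c₂ c₃ μ : ℝ) (x : ℝ → X) (d : ℝ → D) (V : ℝ → ℝ) : Prop where
  nonneg : ∀ t, 0 ≤ V t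
  norm_le : ∀ t, ‖x t‖ ≤ c₁ * V t
  le_norm : ∀ t, V t ≤ c₂ * ‖x t‖
  ac : ∀ T, 0 ≤ T → AbsolutelyContinuousOnInterval V 0 T
  deriv_le : ∀ᵐ t ∂volume.restrict (Ici (0 : ℝ)), deriv V t ≤ -μ * V t + c₃ * ‖d t‖

theorem ae_restrict_Icc_of_Ici {p : ℝ → Prop} (h : ∀ᵐ t ∂volume.restrict (Ici (0 : ℝ)), p t)
    {a b : ℝ} (ha : 0 ≤ a) : ∀ᵐ t ∂volume.restrict (Icc a b), p t :=
  ae_mono (Measure.restrict_mono (Icc_subset_Ici_self.trans (Ici_subset_Ici.2 ha)) le_rfl) h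

theorem ae_norm_le_toReal_eLpNorm_top {D : Type*} [NormedAddCommGroup D] {d : ℝ → D}
    {ν : Measure ℝ} (h : eLpNorm d ∞ ν ≠ ∞) : ∀ᵐ t ∂ν, ‖d t‖ ≤ (eLpNorm d ∞ ν).toReal := by
  filter_upwards [ae_le_eLpNormEssSup (f := d) (μ := ν)] with t ht
  rw [← eLpNorm_exponent_top] at ht
  simpa only [toReal_enorm] using ENNReal.toReal_mono h ht

namespace IsLyapunov

variable {X D : Type*} [NormedAddCommGroup X] [NormedAddCommGroup D]
  {c₁ c₂ c₃ μ : ℝ} {x : ℝ → X} {d : ℝ → D} {V : ℝ → ℝ}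

theorem ac_Icc (h : IsLyapunov c₁ c₂ c₃ μ x d V) {a b : ℝ} (ha : 0 ≤ a) (hab : a ≤ b) :
    AbsolutelyContinuousOnInterval V a b :=
  (h.ac b (ha.trans hab)).mono (by
    rw [uIcc_of_le hab, uIcc_of_le (ha.trans hab)]; exact Icc_subset_Icc_left ha)

theorem norm_le_of_bounded (h : IsLyapunov c₁ c₂ c₃ μ x d V) (hμ : 0 < μ) (hc₁ : 0 ≤ c₁)
    (hc₃ : 0 ≤ c₃) {a b M : ℝ} (ha : 0 ≤ a) (hab : a ≤ b) (hM : 0 ≤ M)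
    (hd : ∀ᵐ t ∂volume.restrict (Icc a b), ‖d t‖ ≤ M) :
    ‖x b‖ ≤ c₁ * c₂ * Real.exp (-μ * (b - a)) * ‖x a‖ + c₁ * c₃ / μ * M := by
  have h1 := (h.ac_Icc ha hab).le_of_deriv_le_add_const hμ (mul_nonneg hc₃ hM) hab (by
    filter_upwards [ae_restrict_Icc_of_Ici h.deriv_le ha, hd] with t h1 h2
    linarith [mul_le_mul_of_nonneg_left h2 hc₃])
  calc ‖x b‖ ≤ c₁ * V b := h.norm_le b
    _ ≤ c₁ * (Real.exp (-μ * (b - a)) * (c₂ * ‖x a‖) + c₃ * M / μ) := by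
        gcongr
        refine h1.trans ?_
        gcongr
        exact h.le_norm a
    _ = _ := by ring

end IsLyapunov

theorem inputToStateStable_of_isLyapunov {X D : Type*} [NormedAddCommGroup X]
    [NormedAddCommGroup D] {B : Set ((ℝ → X) × (ℝ → D))} {c₁ c₂ c₃ μ : ℝ} (hc₁ : 0 < c₁)
    (hc₂ : 0 < c₂) (hc₃ : 0 < c₃) (hμ : 0 < μ)
    (h : ∀ xd ∈ B, ∃ V, IsLyapunov c₁ c₂ c₃ μ xd.1 xd.2 V) : InputToStateStable B := by
  refine ⟨fun r s => c₁ * c₂ * Real.exp (-μ * s) * r, fun r => c₁ * c₃ / μ * r, ?_, ?_, ?_⟩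
  · refine ⟨?_, fun s _ => ⟨by fun_prop, ?_, by simp⟩, fun r hr s _ t _ hst => ?_, fun r _ => ?_⟩
    · exact Continuous.continuousOn (by unfold Function.uncurry; fun_prop)
    · intro a _ b _ hab
      beta_reduce
      gcongr
    · gcongr ?_ * ?_
      gcongr ?_ * Real.exp ?_
      nlinarith
    · have h1 : Tendsto (fun s : ℝ => Real.exp (-μ * s)) atTop (𝓝 0) :=
        Real.tendsto_exp_atBot.comp (tendsto_id.const_mul_atTop_of_neg (by linarith))
      simpa using (h1.const_mul (c₁ * c₂)).mul_const r
  · refine ⟨by fun_prop, fun a _ b _ hab => ?_, by simp⟩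
    gcongr
  · intro xd hxd t₀ t ht₀ ht hd
    obtain ⟨V, hV⟩ := h xd hxd
    exact hV.norm_le_of_bounded hμ hc₁.le hc₃.le ht₀ ht ENNReal.toReal_nonneg
      (ae_norm_le_toReal_eLpNorm_top hd)

theorem finiteGainLpStable_of_isLyapunov {X D : Type*} [NormedAddCommGroup X]
    [NormedAddCommGroup D] {B : Set ((ℝ → X) × (ℝ → D))} {c₁ c₂ c₃ μ : ℝ} (hc₁ : 0 ≤ c₁)
    (hc₂ : 0 ≤ c₂) (hc₃ : 0 ≤ c₃) (hμ : 0 < μ) {p : ℝ≥0∞} (hp : 1 ≤ p)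
    (hm : ∀ xd ∈ B, AEStronglyMeasurable xd.2 (volume.restrict (Ici (0 : ℝ))))
    (h : ∀ xd ∈ B, ∃ V, IsLyapunov c₁ c₂ c₃ μ xd.1 xd.2 V) : FiniteGainLpStable p B := by
  intro η₁ η₂ hη₁ hη₂
  obtain ⟨b, hb, hbound⟩ := exists_eLpNorm_le_of_deriv_le hμ hp
  refine ⟨η₁ * c₁ * (2 / μ * c₃) + η₂, η₁ * c₁ * (b * c₂), by positivity, by positivity, ?_⟩
  rintro ⟨x, d⟩ hxd n y hy τ hτ
  obtain ⟨V, hV⟩ := h _ hxd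
  have hdm := (hm _ hxd).mono_measure
    (Measure.restrict_mono (Icc_subset_Ici_self : Icc 0 τ ⊆ Ici 0) le_rfl)
  dsimp only at hV hy hdm ⊢
  set ν := volume.restrict (Icc 0 τ)
  have hVm : AEStronglyMeasurable V ν := by
    have := (hV.ac τ hτ).continuousOn
    rw [uIcc_of_le hτ] at this
    exact this.aestronglyMeasurable measurableSet_Icc
  have key := hbound V (fun t => c₃ * ‖d t‖) τ hτ (hV.ac τ hτ) hV.nonneg (fun t => by positivity)
    (hdm.norm.const_mul c₃) (ae_restrict_Icc_of_Ici hV.deriv_le le_rfl)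
  have hmul : ∀ (c : ℝ) (f : ℝ → ℝ), 0 ≤ c →
      eLpNorm (fun t => c * f t) p ν = ENNReal.ofReal c * eLpNorm f p ν := fun c f hc => by
    have := eLpNorm_const_smul c f p ν
    rwa [Real.enorm_of_nonneg hc] at this
  rw [hmul c₃ _ hc₃, eLpNorm_norm] at key
  have hη : 0 ≤ η₁ * c₁ := mul_nonneg hη₁ hc₁
  calc eLpNorm y p ν ≤ eLpNorm ((fun t => η₁ * c₁ * V t) + fun t => η₂ * ‖d t‖) p ν := by
        refine eLpNorm_mono_ae_real ?_
        filter_upwards [ae_restrict_Icc_of_Ici hy le_rfl] with t ht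
        have := mul_le_mul_of_nonneg_left (hV.norm_le t) hη₁
        simp only [Pi.add_apply]
        linarith
    _ ≤ eLpNorm (fun t => η₁ * c₁ * V t) p ν + eLpNorm (fun t => η₂ * ‖d t‖) p ν :=
        eLpNorm_add_le (hVm.const_mul _) (hdm.norm.const_mul _) hp
    _ = ENNReal.ofReal (η₁ * c₁) * eLpNorm V p ν + ENNReal.ofReal η₂ * eLpNorm d p ν := by
        rw [hmul _ _ hη, hmul _ _ hη₂, eLpNorm_norm]
    _ ≤ ENNReal.ofReal (η₁ * c₁) * (ENNReal.ofReal (2 / μ) * (ENNReal.ofReal c₃ * eLpNorm d p ν)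
          + ENNReal.ofReal (b * (c₂ * ‖x 0‖))) + ENNReal.ofReal η₂ * eLpNorm d p ν := by
        gcongr
        refine key.trans ?_
        gcongr
        exact hV.le_norm 0
    _ = _ := by
        rw [ENNReal.ofReal_add (by positivity) hη₂, ENNReal.ofReal_mul (p := η₁ * c₁) hη,
          ENNReal.ofReal_mul (p := 2 / μ) (by positivity),
          show η₁ * c₁ * (b * c₂) * ‖x 0‖ = η₁ * c₁ * (b * (c₂ * ‖x 0‖)) by ring,
          ENNReal.ofReal_mul (p := η₁ * c₁) hη]
        ring

/-! ### The Lyapunov function of the cascade and the error ball -/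

/-- The surplus decay of `‖B ω_e‖` beyond `μ` pays for the coupling through `Z` when `‖q_e‖` has a
small weight. The constants depend only on the design, `zbar` and `μ`, hence are uniform over
trajectories. -/
theorem exists_isLyapunov {P : Design} (hJ : P.J.PosDef) (hK : P.K.PosDef) (hLam : P.Lam.PosDef)
    (hqd : ContDiff ℝ 2 P.qd) (zbar : ℝ) {μ : ℝ} (hμK : μ < lambdaMin P.K / lambdaMax P.J)
    (hμL : μ < lambdaMin P.Lam) :
    ∃ c₁ c₂ c₃ : ℝ, 0 < c₁ ∧ 0 < c₂ ∧ 0 < c₃ ∧ ∀ m : Motion, IsClosedLoop P m →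
      (∀ t, 0 ≤ t → sigmaMax (P.rep.Z (m.qhat t)) ≤ zbar) →
      ∃ V, IsLyapunov c₁ c₂ c₃ μ (state P m) (dRes2 P m) V := by
  obtain ⟨B, hB⟩ := exists_transpose_mul_self hJ.posSemidef
  set s := √(lambdaMin P.J) with hs_def
  set S := √(lambdaMax P.J) with hS_def
  set a := lambdaMin P.K / lambdaMax P.J
  have hs : 0 < s := Real.sqrt_pos.2 (lambdaMin_pos hJ)
  have hS : 0 < S := Real.sqrt_pos.2 (lambdaMax_pos hJ)
  -- Chosen so that `c (|zbar| + 1) ‖ω_e‖ ≤ (a - μ) ‖B ω_e‖`; the `+ 1` keeps the denominator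
  -- positive.
  set c := (a - μ) * s / (|zbar| + 1) with hc_def
  have hc : 0 < c := by
    have : 0 < a - μ := by linarith
    positivity
  refine ⟨1 / s + 1 / c, S + c, 1 / s, by positivity, by positivity, by positivity,
    fun m h hz => ⟨fun t => ‖act B (omegaE P m t)‖ + c * ‖qE P m t‖, fun t => by positivity,
      fun t => ?_, fun t => ?_, fun T hT => (h.ac_norm_act_omegaE hqd B T hT).fun_add
        ((h.ac_norm_qE hqd T hT).const_mul c), ?_⟩⟩
  · have h1 := sqrt_lambdaMin_mul_norm_le hJ hB (omegaE P m t)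
    have h2 : ‖omegaE P m t‖ ≤ 1 / s * ‖act B (omegaE P m t)‖ := by
      rw [one_div, inv_mul_eq_div, le_div_iff₀ hs]; linarith
    have h3 : 0 ≤ 1 / s * (c * ‖qE P m t‖) := by positivity
    have h4 : 0 ≤ 1 / c * ‖act B (omegaE P m t)‖ := by positivity
    have h5 : 1 / c * (c * ‖qE P m t‖) = ‖qE P m t‖ := by field_simp
    linarith [norm_state_le P m t]
  · have h1 := norm_le_sqrt_lambdaMax_mul hJ hB (omegaE P m t)
    have h2 := mul_le_mul_of_nonneg_left (norm_omegaE_le_norm_state P m t) hS.le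
    have h3 := mul_le_mul_of_nonneg_left (norm_qE_le_norm_state P m t) hc.le
    linarith
  · filter_upwards [h.ae_deriv_norm_omegaE_le hJ hK hqd hB, h.ae_deriv_norm_qE_le hLam hqd,
      ae_differentiableAt_of_absolutelyContinuousOnInterval (h.ac_norm_act_omegaE hqd B),
      ae_differentiableAt_of_absolutelyContinuousOnInterval (h.ac_norm_qE hqd),
      ae_restrict_mem measurableSet_Ici] with t h1 h2 d1 d2 ht
    rw [deriv_fun_add d1 (d2.const_mul c), deriv_const_mul_field]
    have h3 := sqrt_lambdaMin_mul_norm_le hJ hB (omegaE P m t)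
    have hz' : sigmaMax (P.rep.Z (m.qhat t)) ≤ |zbar| + 1 := by
      linarith [hz t ht, le_abs_self zbar]
    have h4 : c * (sigmaMax (P.rep.Z (m.qhat t)) * ‖omegaE P m t‖) ≤
        (a - μ) * ‖act B (omegaE P m t)‖ :=
      calc c * (sigmaMax (P.rep.Z (m.qhat t)) * ‖omegaE P m t‖)
          ≤ c * ((|zbar| + 1) * ‖omegaE P m t‖) := by gcongr
        _ = (a - μ) * (s * ‖omegaE P m t‖) := by rw [hc_def]; field_simp
        _ ≤ _ := mul_le_mul_of_nonneg_left h3 (by linarith)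
    have h5 := mul_le_mul_of_nonneg_left h2 hc.le
    have h6 : μ * (c * ‖qE P m t‖) ≤ lambdaMin P.Lam * (c * ‖qE P m t‖) := by gcongr
    rw [one_div, inv_mul_eq_div]
    linarith

/-- Exponential convergence of the attitude error to the error ball. -/
theorem IsClosedLoop.norm_qE_le_ballRadius_add {P : Design} {m : Motion} (h : IsClosedLoop P m)
    (hJ : P.J.PosDef) (hK : P.K.PosDef) (hLam : P.Lam.PosDef) (hqd : ContDiff ℝ 2 P.qd)
    {zbar : ℝ} (hz : ∀ t, 0 ≤ t → sigmaMax (P.rep.Z (m.qhat t)) ≤ zbar) {μ : ℝ}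
    (hμK : μ < lambdaMin P.K / lambdaMax P.J) (hμL : μ < lambdaMin P.Lam)
    (hd : eLpNorm (dRes2 P m) ∞ (volume.restrict (Ici (0 : ℝ))) ≠ ∞) {t : ℝ} (ht : 0 ≤ t) :
    ‖qE P m t‖ ≤ ballRadius P m +
      (1 + zbar * (√(lambdaMax P.J) / √(lambdaMin P.J)) / (lambdaMin P.Lam - μ))
        * Real.exp (-μ * t) * ‖state P m 0‖ := by
  obtain ⟨B, hB⟩ := exists_transpose_mul_self hJ.posSemidef
  set Dm := (eLpNorm (dRes2 P m) ∞ (volume.restrict (Ici (0 : ℝ)))).toReal with hDm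
  set z := ⨆ t : Ici (0 : ℝ), sigmaMax (P.rep.Z (m.qhat t)) with hz_def
  have hbdd : BddAbove (range fun t : Ici (0 : ℝ) => sigmaMax (P.rep.Z (m.qhat t))) :=
    ⟨zbar, by rintro _ ⟨t, rfl⟩; exact hz t t.2⟩
  have hzle : ∀ t, 0 ≤ t → sigmaMax (P.rep.Z (m.qhat t)) ≤ z := fun t ht =>
    le_ciSup hbdd ⟨t, ht⟩
  have hz0 : 0 ≤ z := (Real.sqrt_nonneg _).trans (hzle 0 le_rfl)
  have hzz : z ≤ zbar := ciSup_le fun t => hz t t.2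
  have hDm0 : 0 ≤ Dm := ENNReal.toReal_nonneg
  have hJ0 := lambdaMin_pos hJ
  have hJ1 := lambdaMax_pos hJ
  have hK0 := lambdaMin_pos hK
  have hL0 := lambdaMin_pos hLam
  set s := √(lambdaMin P.J) with hs_def
  set S := √(lambdaMax P.J) with hS_def
  set a := lambdaMin P.K / lambdaMax P.J with ha_def
  set l := lambdaMin P.Lam
  set X := ‖state P m 0‖
  have hs : 0 < s := Real.sqrt_pos.2 hJ0
  have hS : 0 < S := Real.sqrt_pos.2 hJ1
  have ha : 0 < a := by positivity
  have hX : 0 ≤ X := norm_nonneg _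
  have hlμ : 0 < l - μ := by linarith
  have hss : s * s = lambdaMin P.J := Real.mul_self_sqrt hJ0.le
  -- First stage of the cascade. The `λ_min(J)` in the last term combines two square roots: one from
  -- the disturbance coefficient, one from returning from `‖B ω_e‖` to `‖ω_e‖`.
  have hom : ∀ t, 0 ≤ t → ‖omegaE P m t‖ ≤
      S / s * X * Real.exp (-μ * t) + Dm / (lambdaMin P.J * a) := by
    intro t ht
    have h1 := (h.ac_norm_act_omegaE hqd B t ht).le_of_deriv_le_add_const (D := Dm / s) ha
      (by positivity) ht (by
        filter_upwards [ae_restrict_Icc_of_Ici (h.ae_deriv_norm_omegaE_le hJ hK hqd hB) le_rfl,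
          ae_restrict_Icc_of_Ici (ae_norm_le_toReal_eLpNorm_top hd) le_rfl] with r h1 h2
        have : ‖dRes2 P m r‖ / s ≤ Dm / s := by gcongr
        linarith)
    have h2 := sqrt_lambdaMin_mul_norm_le hJ hB (omegaE P m t)
    have h3 := (norm_le_sqrt_lambdaMax_mul hJ hB (omegaE P m 0)).trans
      (mul_le_mul_of_nonneg_left (norm_omegaE_le_norm_state P m 0) hS.le)
    have h4 : Real.exp (-a * (t - 0)) ≤ Real.exp (-μ * t) := by
      apply Real.exp_le_exp.2; nlinarith
    have h5 : s * ‖omegaE P m t‖ ≤ Real.exp (-μ * t) * (S * X) + Dm / s / a :=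
      h2.trans (h1.trans (by gcongr))
    have h6 : ‖omegaE P m t‖ ≤ (Real.exp (-μ * t) * (S * X) + Dm / s / a) / s := by
      rw [le_div_iff₀ hs]; linarith
    refine h6.trans_eq ?_
    rw [← hss]
    field_simp
  -- Second stage: the forcing decays at rate `μ` up to a constant, and that constant divided by
  -- `λ_min(Λ_r)` is the radius.
  have hq := (h.ac_norm_qE hqd t ht).le_of_deriv_le_add_exp (C := z * (S / s * X))
    (D := z * (Dm / (lambdaMin P.J * a))) hμL hL0 (by positivity) (by positivity) ht
    (norm_nonneg _) (by
      filter_upwards [ae_restrict_Icc_of_Ici (h.ae_deriv_norm_qE_le hLam hqd) le_rfl,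
        ae_restrict_mem measurableSet_Icc] with r h1 hr
      have h2 : sigmaMax (P.rep.Z (m.qhat r)) * ‖omegaE P m r‖ ≤
          z * (S / s * X * Real.exp (-μ * r) + Dm / (lambdaMin P.J * a)) :=
        mul_le_mul (hzle r hr.1) (hom r hr.1) (norm_nonneg _) hz0
      linarith)
  have hball : z * (Dm / (lambdaMin P.J * a)) / l = ballRadius P m := by
    rw [ballRadius, ← hDm, ← hz_def, ha_def, show lambdaMin P.Lam = l from rfl]
    field_simp
  rw [hball] at hq
  have hq0 := norm_qE_le_norm_state P m 0
  refine hq.trans ?_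
  calc ballRadius P m + (‖qE P m 0‖ + z * (S / s * X) / (l - μ)) * Real.exp (-μ * t)
      ≤ ballRadius P m + (X + zbar * (S / s * X) / (l - μ)) * Real.exp (-μ * t) := by gcongr
    _ = _ := by ring

end AttitudeControl

open AttitudeControl

theorem mainTheorem2 (P : Design) (hJ : P.J.PosDef) (hK : P.K.PosDef) (hLam : P.Lam.PosDef)
    (hqd : ContDiff ℝ 2 P.qd) (zbar : ℝ) :
    (∀ μ : ℝ, 0 < μ → μ < lambdaMin P.K / lambdaMax P.J → μ < lambdaMin P.Lam →
      ∃ C : ℝ, 0 < C ∧ ∀ m : Motion, IsClosedLoop P m →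
        (∀ t, 0 ≤ t → sigmaMax (P.rep.Z (m.qhat t)) ≤ zbar) →
        -- no resultant disturbance: global exponential convergence to the desired trajectory
        (dRes2 P m =ᵐ[volume.restrict (Ici (0 : ℝ))] 0 →
          ∀ t₀ t : ℝ, 0 ≤ t₀ → t₀ ≤ t →
            ‖m.qhat t - P.qd t‖ ≤ C * Real.exp (-μ * (t - t₀)) * ‖state P m t₀‖ ∧
            ‖state P m t‖ ≤ C * Real.exp (-μ * (t - t₀)) * ‖state P m t₀‖) ∧
        -- bounded resultant disturbance: exponential convergence to the error ball
        (eLpNorm (dRes2 P m) ∞ (volume.restrict (Ici (0 : ℝ))) ≠ ∞ →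
          (∀ t : ℝ, 0 ≤ t →
            pathLength 0 (qE P m t)
              ≤ ballRadius P m + C * Real.exp (-μ * t) * ‖state P m 0‖) ∧
          limsup (fun t : ℝ => pathLength 0 (qE P m t)) atTop ≤ ballRadius P m)) ∧
    (∀ p : ℝ≥0∞, 1 ≤ p → FiniteGainLpStable p (behaviour P zbar)) ∧
    InputToStateStable (behaviour P zbar) := by
  refine ⟨fun μ hμ hμK hμL => ?_, ?_⟩
  · obtain ⟨c₁, c₂, c₃, hc₁, hc₂, hc₃, hV⟩ := exists_isLyapunov hJ hK hLam hqd zbar hμK hμL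
    have hl : 0 < lambdaMin P.Lam - μ := by linarith
    -- The absolute value keeps the constant positive when `zbar` is negative, where the claim is
    -- vacuous.
    set c := 1 + |zbar| * (√(lambdaMax P.J) / √(lambdaMin P.J)) / (lambdaMin P.Lam - μ) with hc
    have hc0 : 0 < c := by positivity
    refine ⟨c₁ * c₂ + c, by positivity, fun m h hz => ⟨fun hd t₀ t ht₀ ht => ?_, fun hd => ?_⟩⟩
    · obtain ⟨V, hV⟩ := hV m h hz
      -- The undisturbed case is the bound with `M = 0`.
      have h1 := hV.norm_le_of_bounded hμ hc₁.le hc₃.le ht₀ ht le_rfl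
        ((ae_restrict_Icc_of_Ici (p := fun s => dRes2 P m s = 0) hd ht₀).mono fun s hs => by simp [hs])
      have h2 : ‖state P m t‖ ≤
          (c₁ * c₂ + c) * Real.exp (-μ * (t - t₀)) * ‖state P m t₀‖ := by
        have : 0 ≤ c * Real.exp (-μ * (t - t₀)) * ‖state P m t₀‖ := by positivity
        linarith
      exact ⟨(norm_qE_le_norm_state P m t).trans h2, h2⟩
    · have hle : ∀ t, 0 ≤ t → pathLength 0 (qE P m t) ≤
          ballRadius P m + (c₁ * c₂ + c) * Real.exp (-μ * t) * ‖state P m 0‖ := fun t ht => by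
        refine (pathLength_zero_le _).trans
          ((h.norm_qE_le_ballRadius_add hJ hK hLam hqd hz hμK hμL hd ht).trans ?_)
        gcongr _ + ?_ * _ * _
        refine le_trans ?_ (le_add_of_nonneg_left (mul_pos hc₁ hc₂).le)
        rw [hc]
        gcongr
        exact le_abs_self zbar
      refine ⟨hle, ?_⟩
      have h1 : Tendsto (fun t : ℝ => Real.exp (-μ * t)) atTop (𝓝 0) :=
        Real.tendsto_exp_atBot.comp (tendsto_id.const_mul_atTop_of_neg (by linarith))
      have h2 : Tendsto (fun t : ℝ => ballRadius P m +
          (c₁ * c₂ + c) * Real.exp (-μ * t) * ‖state P m 0‖) atTop (𝓝 (ballRadius P m)) := by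
        simpa using ((h1.const_mul (c₁ * c₂ + c)).mul_const ‖state P m 0‖).const_add
          (ballRadius P m)
      rw [← h2.limsup_eq]
      exact limsup_le_limsup (eventually_atTop.2 ⟨0, hle⟩)
        (isCoboundedUnder_le_of_le atTop fun t => pathLength_nonneg 0 (qE P m t))
        h2.isBoundedUnder_le
  -- The stability claims do not mention a rate, so half of the admissible supremum serves.
  · have ha : 0 < lambdaMin P.K / lambdaMax P.J := div_pos (lambdaMin_pos hK) (lambdaMax_pos hJ)
    have hm := lt_min ha (lambdaMin_pos hLam)
    obtain ⟨c₁, c₂, c₃, hc₁, hc₂, hc₃, hV⟩ := exists_isLyapunov hJ hK hLam hqd zbar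
      (half_lt_self hm |>.trans_le (min_le_left _ _)) (half_lt_self hm |>.trans_le (min_le_right _ _))
    have hB : ∀ xd ∈ behaviour P zbar, ∃ V, IsLyapunov c₁ c₂ c₃
        (min (lambdaMin P.K / lambdaMax P.J) (lambdaMin P.Lam) / 2) xd.1 xd.2 V := by
      rintro _ ⟨m, h, hz, rfl⟩
      exact hV m h hz
    refine ⟨fun p hp => finiteGainLpStable_of_isLyapunov hc₁.le hc₂.le hc₃.le (half_pos hm) hp
      ?_ hB, inputToStateStable_of_isLyapunov hc₁ hc₂ hc₃ (half_pos hm) hB⟩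
    rintro _ ⟨m, h, -, rfl⟩
    exact h.aestronglyMeasurable_dRes2 hqd
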